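/- Throughout, a distribution means the distribution function $F(x)=P(X\le x)$ of a nonnegative random variable $X$, and $\overline F=1-F$. Let $\mathcal M$ be the class of positive measurable functions $U$ on $(0,\infty)$, bounded on finite intervals, for which there is $\rho\in\mathbb R$ (then unique, denoted $\rho_U$) such that for every $\varepsilon>0$ $$\lim_{x\to\infty}\frac{U(x)}{x^{\rho+\varepsilon}}=0,\qquad \lim_{x\to\infty}\frac{U(x)}{x^{\rho-\varepsilon}}=\infty .$$ The $\mathcal M$-index of $U$ is $\kappa_U=\sup\{r\in\mathbb R:\int_1^\infty x^{r-1}U(x)\,dx<\infty\}\in[-\infty,\infty]$. Let $\mathcal M_\infty$ be the class of positive measurable functions $U$ on $(0,\infty)$, bounded on finite intervals, with $\lim_{x\to\infty}U(x)/x^{\rho}=0$ for every $\rho\in\mathbb R$ (if $U$ is given on $\mathbb R$, its restriction to $(0,\infty)$ is meant). For a continuous distribution function $G$ on $\mathbb R$, let $DA(G)$ be the set of distributions $F$ for which there are $a_n>0$ and $b_n\in\mathbb R$ with $F(a_nx+b_n)^n\to G(x)$ as $n\to\infty$ for all $x\in\mathbb R$. Let $\Phi_\alpha(x)=\exp(-x^{-\alpha})$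 for $x>0$ and $\Phi_\alpha(x)=0$ for $x\le 0$ (where $\alpha>0$), let $\Lambda(x)=\exp(-e^{-x})$ for $x\in\mathbb R$, and let $DA(\Lambda_\infty)$ be the set of $F\in DA(\Lambda)$ with $\sup\{x:F(x)<1\}=\infty$. **Theorem.** (i) For every $\alpha>0$, if $F\in DA(\Phi_\alpha)$ then $\overline F\in\mathcal M$ with $\rho_{\overline F}=-\alpha$ and $\mathcal M$-index $\kappa_{\overline F}=\alpha$. The converse does not hold: for every $\alpha>0$, $$DA(\Phi_\alpha)\subsetneq\{F:\overline F\in\mathcal M,\ \rho_{\overline F}=-\alpha,\ \kappa_{\overline F}=\alpha\},$$ and moreover $$\bigcup_{\alpha>0}DA(\Phi_\alpha)\subsetneq\{F:\overline F\in\mathcal M\}.$$ The Peter and Paul distribution $F(x)=1-\sum_{k\ge1,\;2^k>x}2^{-k}$ satisfies $\overline F\in\mathcal M$ with $\rho_{\overline F}=-1$ and $\kappa_{\overline F}=1$, but belongs to $DA(\Phi_\alpha)$ for no $\alpha>0$. (ii) $DA(\Lambda_\infty)\subsetneq\{F:\overline F\in\mathcal M_\infty\}$. There are distributions $F$ with $\overline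 F(x)=\exp(-\lfloor x\rfloor\log x)$ for all sufficiently large $x$, and every such $F$ satisfies $\overline F\in\mathcal M_\infty$ and $F\notin DA(\Lambda_\infty)$. -/

import Mathlib

open Filter Topology MeasureTheory

noncomputable section

namespace TailClasses

/-- `F` is the (right-continuous) distribution function `x ↦ P(X ≤ x)` of a real random variable. -/
def IsDistribution (F : ℝ → ℝ) : Prop :=
  ∃ μ : Measure ℝ, IsProbabilityMeasure μ ∧ ∀ x, F x = ProbabilityTheory.cdf μ x

/-- Distribution functions of nonnegative random variables. -/
def distributionsOnRPlus : Set (ℝ → ℝ) :=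
  {F | IsDistribution F ∧ ∀ x < 0, F x = 0}

/-- The tail `1 - F`. -/
def tail (F : ℝ → ℝ) : ℝ → ℝ := fun x => 1 - F x

/-- Positive (Lebesgue) measurable functions on `(0, ∞)`, bounded on finite intervals.
Values outside `(0, ∞)` are irrelevant. -/
structure IsAdmissible (U : ℝ → ℝ) : Prop where
  pos : ∀ x > 0, 0 < U x
  measurable : AEMeasurable U (volume.restrict (Set.Ioi 0))
  bounded : ∀ b > 0, ∃ C, ∀ x ∈ Set.Ioc 0 b, U x ≤ C

/-- `U` is compared with powers at infinity with exponent `ρ`: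
`U(x) / x^(ρ+ε) → 0` and `U(x) / x^(ρ-ε) → ∞` for all `ε > 0`. -/
def HasPowerOrder (U : ℝ → ℝ) (ρ : ℝ) : Prop :=
  ∀ ε > 0, Tendsto (fun x : ℝ => U x / x ^ (ρ + ε)) atTop (𝓝 0) ∧
    Tendsto (fun x : ℝ => U x / x ^ (ρ - ε)) atTop atTop

/-- The class `M`. -/
def classM : Set (ℝ → ℝ) := {U | IsAdmissible U ∧ ∃ ρ : ℝ, HasPowerOrder U ρ}

/-- The class `M_∞`. -/
def classMInfty : Set (ℝ → ℝ) :=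
  {U | IsAdmissible U ∧ ∀ ρ : ℝ, Tendsto (fun x : ℝ => U x / x ^ ρ) atTop (𝓝 0)}

/-- The index `κ_U = sup {r ∈ ℝ : ∫_1^∞ x^(r-1) U(x) dx < ∞}`, an extended real. -/
def mIndex (U : ℝ → ℝ) : EReal :=
  sSup {s : EReal | ∃ r : ℝ, s = r ∧
    ∫⁻ x in Set.Ioi (1 : ℝ), ENNReal.ofReal (x ^ (r - 1) * U x) < ⊤}

/-- The Fréchet distribution function `Φ_α`. -/
def frechet (α : ℝ) : ℝ → ℝ := fun x => if x ≤ 0 then 0 else Real.exp (-x ^ (-α))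

/-- The Gumbel distribution function `Λ`. -/
def gumbel : ℝ → ℝ := fun x => Real.exp (-Real.exp (-x))

/-- `DA(G)` within the distributions on `[0, ∞)`, for a continuous limit `G` (as `Φ_α` and `Λ`
are), so that convergence in law is convergence at every point. -/
def domainOfAttraction (G : ℝ → ℝ) : Set (ℝ → ℝ) :=
  {F | F ∈ distributionsOnRPlus ∧ ∃ a b : ℕ → ℝ, (∀ n, 0 < a n) ∧
    ∀ x : ℝ, Tendsto (fun n : ℕ => F (a n * x + b n) ^ n) atTop (𝓝 (G x))}

/-- The right endpoint `x* = sup {x : F(x) < 1}`. -/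
def rightEndpoint (F : ℝ → ℝ) : EReal := sSup {s : EReal | ∃ x : ℝ, s = x ∧ F x < 1}

/-- `DA(Λ_∞)`: members of `DA(Λ)` with infinite right endpoint. -/
def daGumbelInfty : Set (ℝ → ℝ) :=
  {F | F ∈ domainOfAttraction gumbel ∧ rightEndpoint F = ⊤}

/-- The Peter and Paul distribution `F(x) = 1 - ∑_{k ≥ 1, 2^k > x} 2^(-k)`. -/
def peterPaul : ℝ → ℝ := fun x =>
  1 - ∑' k : ℕ, if 1 ≤ k ∧ x < (2 : ℝ) ^ k then ((2 : ℝ) ^ k)⁻¹ else 0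

end TailClasses

end

open TailClasses

/-!
Everything is read off from the logarithmic quotient `log t / log U(t)` of a tail `U = 1 - F`. If it
tends to `-1 / α`, then `U` has power order `-α` (`hasPowerOrder_of_tendsto_log`), and the index is
then `α` by comparison with integrals of powers (`HasPowerOrder.mIndex_eq`); if it tends to `0`, then
`U` decays faster than every power (`tendsto_div_rpow_zero`).

For `F` in a domain of attraction, `n * U (a n * y + b n)` tends to `g y = -log (G y)`. No regular
variation theory is needed: the norming points `x k = a (2 ^ k) * y₀ + b (2 ^ k)` along the powers of
two suffice. Comparing `n`, `2 * n` and `4 * n` through the monotonicity of `U` locates `x (k + 1)`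
and `x (k + 2)` relative to `x k` on the scale `a (2 ^ k)`, so the increments of `x` have ratios
tending to a constant `l`, whatever the centring `b` (`dyadic_increments`); here `l = 2 ^ (1 / α)` for
the Fréchet law and `l = 1` for the Gumbel law. By a Stolz–Cesàro argument the ratios
`x (k + 1) / x k` tend to `l` as well (`tendsto_ratio_of_diff_ratio`). Since `2 ^ k * U (x k)` has a
positive limit, monotonicity of `U` gives `log t / log U(t) → -log l / log 2`
(`tendsto_log_div_log`).

The examples lie outside the domains of attraction because of their jumps
(`notMem_domainOfAttraction`): `n * U` avoids the interval `(1, 2)` for infinitely many `n`, whereas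
its limits include `3 / 2`. For the laws with tail `2 ^ (-k)` on `2 ^ k ≤ x ^ α < 2 ^ (k + 1)`, of
which Peter and Paul is the case `α = 1`, take `n = 2 ^ m`; for the tails `exp (-⌊x⌋ log x)` take
`n = m ^ m`.
-/

namespace TailClasses

/-! ### Growth of real sequences -/

lemma tendsto_succ_div_self : Tendsto (fun k : ℕ => ((k + 1 : ℕ) : ℝ) / k) atTop (𝓝 1) := by
  have h : Tendsto (fun k : ℕ => 1 + (1 : ℝ) / k) atTop (𝓝 (1 + 0)) :=
    tendsto_const_nhds.add tendsto_one_div_atTop_nhds_zero_nat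
  rw [add_zero] at h
  refine h.congr' ?_
  filter_upwards [eventually_gt_atTop 0] with k hk
  have : (k : ℝ) ≠ 0 := by positivity
  push_cast
  field_simp

lemma tendsto_shift_div {s : ℕ → ℝ} {L : ℝ} (h : Tendsto (fun k : ℕ => s k / k) atTop (𝓝 L)) :
    Tendsto (fun k : ℕ => s (k + 1) / k) atTop (𝓝 L) := by
  have h1 := ((tendsto_add_atTop_iff_nat 1).2 h).mul tendsto_succ_div_self
  rw [mul_one] at h1
  refine h1.congr fun k => ?_
  have : ((k + 1 : ℕ) : ℝ) ≠ 0 := by positivity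
  exact div_mul_div_cancel₀ this

/-- The logarithms of a sequence with ratios tending to `l > 0` grow linearly with slope `log l`,
by Cesàro's theorem for the increments of the logarithm. -/
lemma tendsto_log_div_nat {x : ℕ → ℝ} {l : ℝ} (hl : 0 < l) (hx : Tendsto x atTop atTop)
    (hr : Tendsto (fun k => x (k + 1) / x k) atTop (𝓝 l)) :
    Tendsto (fun k : ℕ => Real.log (x k) / k) atTop (𝓝 (Real.log l)) := by
  have h1 : Tendsto (fun k => Real.log (x (k + 1)) - Real.log (x k)) atTop (𝓝 (Real.log l)) := by
    refine (hr.log hl.ne').congr' ?_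
    filter_upwards [hx.eventually_gt_atTop 0,
      (hx.comp (tendsto_add_atTop_nat 1)).eventually_gt_atTop 0] with k h0 h1
    exact Real.log_div (ne_of_gt h1) h0.ne'
  have h2 := h1.cesaro
  simp only [Finset.sum_range_sub (fun k => Real.log (x k))] at h2
  have h3 : Tendsto (fun k : ℕ => Real.log (x 0) / k) atTop (𝓝 0) :=
    tendsto_const_div_atTop_nhds_zero_nat _
  have h4 := h2.add h3
  rw [add_zero] at h4
  refine h4.congr fun k => ?_
  ring

lemma exists_pos_le_diff {x : ℕ → ℝ} {l : ℝ} (hl : 1 < l) (hd : ∀ᶠ k in atTop, x k < x (k + 1))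
    (hr : Tendsto (fun k => (x (k + 2) - x (k + 1)) / (x (k + 1) - x k)) atTop (𝓝 l)) :
    ∃ c > 0, ∀ᶠ k in atTop, c ≤ x (k + 1) - x k := by
  obtain ⟨N, hN⟩ := eventually_atTop.1 (hd.and (hr.eventually (lt_mem_nhds hl)))
  refine ⟨x (N + 1) - x N, sub_pos.2 (hN N le_rfl).1, eventually_atTop.2 ⟨N, fun k hk => ?_⟩⟩
  induction k, hk using Nat.le_induction with
  | base => exact le_rfl
  | succ k hk ih =>
    have h := (hN k hk).2
    rw [lt_div_iff₀ (sub_pos.2 (hN k hk).1)] at h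
    have e : k + 1 + 1 = k + 2 := rfl
    rw [e]
    linarith

/-- A sequence whose increments are eventually positive and grow by a ratio with limit `> 1`
tends to infinity. -/
lemma tendsto_atTop_of_diff_ratio {x : ℕ → ℝ} {l : ℝ} (hl : 1 < l)
    (hd : ∀ᶠ k in atTop, x k < x (k + 1))
    (hr : Tendsto (fun k => (x (k + 2) - x (k + 1)) / (x (k + 1) - x k)) atTop (𝓝 l)) :
    Tendsto x atTop atTop := by
  obtain ⟨c, hc, h⟩ := exists_pos_le_diff hl hd hr
  obtain ⟨N, hN⟩ := eventually_atTop.1 h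
  have h1 : ∀ k : ℕ, x N + k * c ≤ x (k + N) := by
    intro k
    induction k with
    | zero => simp
    | succ k ih =>
      have := hN (k + N) (by omega)
      have e : k + 1 + N = k + N + 1 := by ring
      rw [e]
      push_cast
      linarith
  refine (tendsto_add_atTop_iff_nat N).1 (tendsto_atTop_mono h1 ?_)
  exact tendsto_atTop_add_const_left _ _ (tendsto_natCast_atTop_atTop.atTop_mul_const hc)

/-- A Stolz–Cesàro statement: if the increments have ratios tending to `l`, so does the sequence
itself. -/
lemma tendsto_ratio_of_diff_ratio {x : ℕ → ℝ} {l : ℝ} (hx : Tendsto x atTop atTop)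
    (hd : ∀ᶠ k in atTop, x k < x (k + 1))
    (hr : Tendsto (fun k => (x (k + 2) - x (k + 1)) / (x (k + 1) - x k)) atTop (𝓝 l)) :
    Tendsto (fun k => x (k + 1) / x k) atTop (𝓝 l) := by
  rw [tendsto_order]
  constructor
  · intro m hm
    obtain ⟨m', hm1, hm2⟩ := exists_between hm
    obtain ⟨N, hN⟩ := eventually_atTop.1 (hd.and (hr.eventually (lt_mem_nhds hm2)))
    -- `x (k + 1) - m' * x k` is eventually nondecreasing, hence bounded below
    have h1 : ∀ k ≥ N, x (N + 1) - m' * x N ≤ x (k + 1) - m' * x k := by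
      intro k hk
      induction k, hk using Nat.le_induction with
      | base => exact le_rfl
      | succ k hk ih =>
        have h := (hN k hk).2
        rw [lt_div_iff₀ (sub_pos.2 (hN k hk).1)] at h
        have e : k + 1 + 1 = k + 2 := rfl
        rw [e]
        linarith
    filter_upwards [eventually_ge_atTop N, hx.eventually_gt_atTop 0,
      (hx.const_mul_atTop (sub_pos.2 hm1)).eventually_gt_atTop (-(x (N + 1) - m' * x N))]
      with k hk h0 h2
    rw [lt_div_iff₀ h0]
    have := h1 k hk
    linarith
  · intro m hm
    obtain ⟨m', hm1, hm2⟩ := exists_between hm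
    obtain ⟨N, hN⟩ := eventually_atTop.1 (hd.and (hr.eventually (gt_mem_nhds hm1)))
    -- `x (k + 1) - m' * x k` is eventually nonincreasing, hence bounded above
    have h1 : ∀ k ≥ N, x (k + 1) - m' * x k ≤ x (N + 1) - m' * x N := by
      intro k hk
      induction k, hk using Nat.le_induction with
      | base => exact le_rfl
      | succ k hk ih =>
        have h := (hN k hk).2
        rw [div_lt_iff₀ (sub_pos.2 (hN k hk).1)] at h
        have e : k + 1 + 1 = k + 2 := rfl
        rw [e]
        linarith
    filter_upwards [eventually_ge_atTop N, hx.eventually_gt_atTop 0,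
      (hx.const_mul_atTop (sub_pos.2 hm2)).eventually_gt_atTop (x (N + 1) - m' * x N)]
      with k hk h0 h2
    rw [div_lt_iff₀ h0]
    have := h1 k hk
    linarith

/-- The half-lines beyond a sequence tending to infinity are covered by the intervals between
consecutive terms, with indices tending to infinity. -/
lemma exists_bracketing_index {x : ℕ → ℝ} (hx : Tendsto x atTop atTop) :
    ∃ κ : ℝ → ℕ, Tendsto κ atTop atTop ∧ ∀ᶠ t in atTop, x (κ t) ≤ t ∧ t < x (κ t + 1) := by
  classical
  have hex : ∀ t, ∃ k, t < x k := fun t => (hx.eventually_gt_atTop t).exists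
  have hlt : ∀ K, ∀ᶠ t in atTop, K < Nat.find (hex t) := by
    intro K
    have : ∀ᶠ t in atTop, ∀ j ∈ Finset.range (K + 1), x j ≤ t :=
      (Filter.eventually_all_finset _).2 fun j _ => eventually_ge_atTop _
    filter_upwards [this] with t ht
    rw [Nat.lt_find_iff]
    intro m hm
    exact not_lt.2 (ht m (Finset.mem_range.2 (by omega)))
  refine ⟨fun t => Nat.find (hex t) - 1, ?_, ?_⟩
  · refine tendsto_atTop.2 fun K => ?_
    filter_upwards [hlt K] with t ht
    omega
  · filter_upwards [hlt 0] with t ht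
    have h1 : Nat.find (hex t) - 1 + 1 = Nat.find (hex t) := by omega
    rw [h1]
    exact ⟨not_lt.1 (Nat.find_min (hex t) (by omega)), Nat.find_spec (hex t)⟩

/-! ### Power order from values along a sequence -/

/-- A nonincreasing `U` is controlled at infinity by its values along a sequence whose consecutive
terms have ratios tending to `l` if `U` decays like `2 ^ (-k)` along it: then
`log t / log U(t) → -log l / log 2`. -/
lemma tendsto_log_div_log {U : ℝ → ℝ} {x : ℕ → ℝ} {l c : ℝ} (hU : Antitone U) (hpos : ∀ t, 0 < U t)
    (hl : 0 < l) (hc : 0 < c) (hx : Tendsto x atTop atTop)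
    (hr : Tendsto (fun k => x (k + 1) / x k) atTop (𝓝 l))
    (h2 : Tendsto (fun k => 2 ^ k * U (x k)) atTop (𝓝 c)) :
    Tendsto (fun t => Real.log t / Real.log (U t)) atTop (𝓝 (-(Real.log l / Real.log 2))) := by
  have hlog2 : 0 < Real.log 2 := Real.log_pos one_lt_two
  have hX := tendsto_log_div_nat hl hx hr
  have hV : Tendsto (fun k : ℕ => Real.log (U (x k)) / k) atTop (𝓝 (-Real.log 2)) := by
    have h3 := (h2.log hc.ne').mul tendsto_one_div_atTop_nhds_zero_nat
    have h4 := h3.sub_const (Real.log 2)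
    rw [mul_zero, zero_sub] at h4
    refine h4.congr' ?_
    filter_upwards [eventually_gt_atTop 0] with k hk
    have : (k : ℝ) ≠ 0 := by positivity
    rw [Real.log_mul (by positivity) (hpos _).ne', Real.log_pow]
    field_simp
    ring
  obtain ⟨κ, hκ, hb⟩ := exists_bracketing_index hx
  have hA : Tendsto (fun t => Real.log t / κ t) atTop (𝓝 (Real.log l)) := by
    refine tendsto_of_tendsto_of_tendsto_of_le_of_le' (hX.comp hκ)
      ((tendsto_shift_div hX).comp hκ) ?_ ?_
    · filter_upwards [hb, (hx.comp hκ).eventually_gt_atTop 0] with t ht h0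
      have := Real.log_le_log h0 ht.1
      exact div_le_div_of_nonneg_right this (Nat.cast_nonneg _)
    · filter_upwards [hb, eventually_gt_atTop 0] with t ht h0
      have := Real.log_le_log h0 ht.2.le
      exact div_le_div_of_nonneg_right this (Nat.cast_nonneg _)
  have hB : Tendsto (fun t => Real.log (U t) / κ t) atTop (𝓝 (-Real.log 2)) := by
    refine tendsto_of_tendsto_of_tendsto_of_le_of_le'
      ((tendsto_shift_div hV).comp hκ) (hV.comp hκ) ?_ ?_
    · filter_upwards [hb] with t ht
      have := Real.log_le_log (hpos _) (hU ht.2.le)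
      exact div_le_div_of_nonneg_right this (Nat.cast_nonneg _)
    · filter_upwards [hb] with t ht
      have := Real.log_le_log (hpos _) (hU ht.1)
      exact div_le_div_of_nonneg_right this (Nat.cast_nonneg _)
  have hC := hA.div hB (neg_ne_zero.2 hlog2.ne')
  rw [div_neg] at hC
  refine hC.congr' ?_
  filter_upwards [hκ.eventually_gt_atTop 0] with t ht
  have : (κ t : ℝ) ≠ 0 := by positivity
  exact div_div_div_cancel_right₀ this _ _

/-- For `U → 0` with `log t / log U(t) → -γ`, write
`U(t) / t ^ r = exp (log U(t) * (1 - r * (log t / log U(t))))`; the second factor tends to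
`1 + r * γ`. -/
lemma div_rpow_eventuallyEq {U : ℝ → ℝ} (hpos : ∀ t, 0 < U t) (h0 : Tendsto U atTop (𝓝 0)) (r : ℝ) :
    (fun t => Real.exp (Real.log (U t) * (1 - r * (Real.log t / Real.log (U t))))) =ᶠ[atTop]
      fun t => U t / t ^ r := by
  filter_upwards [eventually_gt_atTop 0, h0.eventually (gt_mem_nhds one_pos)] with t ht h1
  have h2 : Real.log (U t) ≠ 0 := (Real.log_neg (hpos t) h1).ne
  have h3 : Real.log (U t) * (1 - r * (Real.log t / Real.log (U t)))
      = Real.log (U t) - Real.log t * r := by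
    field_simp
  rw [h3, Real.exp_sub, Real.exp_log (hpos t), Real.rpow_def_of_pos ht]

lemma tendsto_div_rpow_zero {U : ℝ → ℝ} {γ r : ℝ} (hpos : ∀ t, 0 < U t)
    (h0 : Tendsto U atTop (𝓝 0))
    (h : Tendsto (fun t => Real.log t / Real.log (U t)) atTop (𝓝 (-γ))) (hr : 0 < 1 + r * γ) :
    Tendsto (fun t : ℝ => U t / t ^ r) atTop (𝓝 0) := by
  refine Tendsto.congr' (div_rpow_eventuallyEq hpos h0 r) (Real.tendsto_exp_atBot.comp ?_)
  have hlog : Tendsto (fun t => Real.log (U t)) atTop atBot :=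
    Real.tendsto_log_nhdsGT_zero.comp
      (tendsto_nhdsWithin_iff.2 ⟨h0, Eventually.of_forall fun t => hpos t⟩)
  refine hlog.atBot_mul_pos (C := 1 - r * -γ) (by linarith) ?_
  exact tendsto_const_nhds.sub (h.const_mul r)

lemma tendsto_div_rpow_atTop {U : ℝ → ℝ} {γ r : ℝ} (hpos : ∀ t, 0 < U t)
    (h0 : Tendsto U atTop (𝓝 0))
    (h : Tendsto (fun t => Real.log t / Real.log (U t)) atTop (𝓝 (-γ))) (hr : 1 + r * γ < 0) :
    Tendsto (fun t : ℝ => U t / t ^ r) atTop atTop := by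
  refine Tendsto.congr' (div_rpow_eventuallyEq hpos h0 r) (Real.tendsto_exp_atTop.comp ?_)
  have hlog : Tendsto (fun t => Real.log (U t)) atTop atBot :=
    Real.tendsto_log_nhdsGT_zero.comp
      (tendsto_nhdsWithin_iff.2 ⟨h0, Eventually.of_forall fun t => hpos t⟩)
  refine hlog.atBot_mul_neg (C := 1 - r * -γ) (by linarith) ?_
  exact tendsto_const_nhds.sub (h.const_mul r)

lemma hasPowerOrder_of_tendsto_log {U : ℝ → ℝ} {α : ℝ} (hα : 0 < α) (hpos : ∀ t, 0 < U t)
    (h0 : Tendsto U atTop (𝓝 0))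
    (h : Tendsto (fun t => Real.log t / Real.log (U t)) atTop (𝓝 (-α⁻¹))) :
    HasPowerOrder U (-α) := by
  intro ε hε
  have h1 : 0 < ε * α⁻¹ := by positivity
  have h2 : α * α⁻¹ = 1 := mul_inv_cancel₀ hα.ne'
  exact ⟨tendsto_div_rpow_zero hpos h0 h (by linarith),
    tendsto_div_rpow_atTop hpos h0 h (by linarith)⟩

/-! ### The index of a function with a power order -/

lemma lintegral_rpow_mul_lt_top {U : ℝ → ℝ} {α r : ℝ} (hU : IsAdmissible U)
    (h : HasPowerOrder U (-α)) (hr : r < α) :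
    ∫⁻ x in Set.Ioi (1 : ℝ), ENNReal.ofReal (x ^ (r - 1) * U x) < ⊤ := by
  obtain ⟨X, hX⟩ := eventually_atTop.1
    (((h ((α - r) / 2) (by linarith)).1.eventually (gt_mem_nhds one_pos)).and
      (eventually_ge_atTop (1 : ℝ)))
  have hX1 : 1 ≤ X := (hX X le_rfl).2
  rw [← Set.Ioc_union_Ioi_eq_Ioi hX1]
  refine (lintegral_union_le _ _ _).trans_lt (ENNReal.add_lt_top.2 ⟨?_, ?_⟩)
  · obtain ⟨C, hC⟩ := hU.bounded X (by linarith)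
    have hcont : ContinuousOn (fun x : ℝ => x ^ (r - 1)) (Set.Icc 1 X) := fun x hx =>
      (Real.continuousAt_rpow_const _ _ (Or.inl (by linarith [hx.1]))).continuousWithinAt
    have hint : IntegrableOn (fun x : ℝ => x ^ (r - 1) * C) (Set.Ioc 1 X) :=
      ((hcont.mul continuousOn_const).integrableOn_Icc).mono_set Set.Ioc_subset_Icc_self
    refine lt_of_le_of_lt ?_ hint.setLIntegral_lt_top
    refine setLIntegral_mono' measurableSet_Ioc fun x hx => ENNReal.ofReal_le_ofReal ?_
    have hx0 : 0 < x := by linarith [hx.1]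
    exact mul_le_mul_of_nonneg_left (hC x ⟨hx0, hx.2⟩) (Real.rpow_nonneg hx0.le _)
  · have hint := integrableOn_Ioi_rpow_of_lt (a := -1 - (α - r) / 2) (c := X) (by linarith)
      (by linarith)
    refine lt_of_le_of_lt ?_ hint.setLIntegral_lt_top
    refine setLIntegral_mono' measurableSet_Ioi fun x hx => ENNReal.ofReal_le_ofReal ?_
    have hx0 : 0 < x := by linarith [Set.mem_Ioi.1 hx]
    have h1 := (hX x (le_of_lt hx)).1
    rw [div_lt_one (Real.rpow_pos_of_pos hx0 _)] at h1
    calc x ^ (r - 1) * U x ≤ x ^ (r - 1) * x ^ (-α + (α - r) / 2) :=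
          mul_le_mul_of_nonneg_left h1.le (Real.rpow_nonneg hx0.le _)
      _ = x ^ (-1 - (α - r) / 2) := by
          rw [← Real.rpow_add hx0]
          congr 1
          ring

lemma lintegral_rpow_mul_eq_top {U : ℝ → ℝ} {α r : ℝ}
    (h : HasPowerOrder U (-α)) (hr : α < r) :
    ∫⁻ x in Set.Ioi (1 : ℝ), ENNReal.ofReal (x ^ (r - 1) * U x) = ⊤ := by
  obtain ⟨X, hX⟩ := eventually_atTop.1
    (((h (r - α) (by linarith)).2.eventually_ge_atTop 1).and (eventually_ge_atTop (1 : ℝ)))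
  have hX1 : 1 ≤ X := (hX X le_rfl).2
  have hle : ∫⁻ x in Set.Ioi X, ENNReal.ofReal (x ^ (-1 : ℝ)) ≤
      ∫⁻ x in Set.Ioi (1 : ℝ), ENNReal.ofReal (x ^ (r - 1) * U x) := by
    refine le_trans (setLIntegral_mono' measurableSet_Ioi fun x hx => ?_)
      (lintegral_mono_set (Set.Ioi_subset_Ioi hX1))
    refine ENNReal.ofReal_le_ofReal ?_
    have hx0 : 0 < x := by linarith [Set.mem_Ioi.1 hx]
    have h1 := (hX x (le_of_lt hx)).1
    rw [one_le_div (Real.rpow_pos_of_pos hx0 _)] at h1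
    calc x ^ (-1 : ℝ) = x ^ (r - 1) * x ^ (-α - (r - α)) := by
          rw [← Real.rpow_add hx0]
          congr 1
          ring
      _ ≤ x ^ (r - 1) * U x := mul_le_mul_of_nonneg_left h1 (Real.rpow_nonneg hx0.le _)
  by_contra hne
  have hfin := ne_top_of_le_ne_top hne hle
  have hmeas : AEStronglyMeasurable (fun x : ℝ => x ^ (-1 : ℝ)) (volume.restrict (Set.Ioi X)) :=
    (by fun_prop : Measurable fun x : ℝ => x ^ (-1 : ℝ)).aestronglyMeasurable
  have hnn : 0 ≤ᵐ[volume.restrict (Set.Ioi X)] fun x : ℝ => x ^ (-1 : ℝ) := by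
    refine (ae_restrict_iff' measurableSet_Ioi).2 (Eventually.of_forall fun x hx => ?_)
    exact Real.rpow_nonneg (by linarith [Set.mem_Ioi.1 hx]) _
  have := (integrableOn_Ioi_rpow_iff (by linarith : (0 : ℝ) < X)).1
    ((lintegral_ofReal_ne_top_iff_integrable hmeas hnn).1 hfin)
  exact lt_irrefl _ this

lemma HasPowerOrder.mIndex_eq {U : ℝ → ℝ} {α : ℝ} (hU : IsAdmissible U)
    (h : HasPowerOrder U (-α)) : mIndex U = (α : EReal) := by
  refine le_antisymm (sSup_le ?_) (le_of_forall_lt fun c hc => ?_)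
  · rintro s ⟨r, rfl, hr⟩
    rw [EReal.coe_le_coe_iff]
    by_contra! hlt
    exact hr.ne (lintegral_rpow_mul_eq_top h hlt)
  · obtain ⟨r, hcr, hr⟩ := EReal.lt_iff_exists_real_btwn.1 hc
    exact hcr.trans_le
      (le_sSup ⟨r, rfl, lintegral_rpow_mul_lt_top hU h (EReal.coe_lt_coe_iff.1 hr)⟩)

/-! ### Distributions and their tails -/

lemma monotone_of_mem {F : ℝ → ℝ} (hF : F ∈ distributionsOnRPlus) : Monotone F := by
  obtain ⟨⟨μ, _, h⟩, -⟩ := hF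
  rw [funext h]
  exact ProbabilityTheory.monotone_cdf μ

lemma nonneg_of_mem {F : ℝ → ℝ} (hF : F ∈ distributionsOnRPlus) (x : ℝ) : 0 ≤ F x := by
  obtain ⟨⟨μ, _, h⟩, -⟩ := hF
  rw [h]
  exact ProbabilityTheory.cdf_nonneg μ x

lemma antitone_tail {F : ℝ → ℝ} (hF : F ∈ distributionsOnRPlus) : Antitone (tail F) :=
  fun _ _ h => sub_le_sub_left (monotone_of_mem hF h) 1

lemma tail_le_one {F : ℝ → ℝ} (hF : F ∈ distributionsOnRPlus) (x : ℝ) : tail F x ≤ 1 :=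
  sub_le_self 1 (nonneg_of_mem hF x)

lemma tendsto_tail {F : ℝ → ℝ} (hF : F ∈ distributionsOnRPlus) :
    Tendsto (tail F) atTop (𝓝 0) := by
  obtain ⟨⟨μ, _, h⟩, -⟩ := hF
  have := (ProbabilityTheory.tendsto_cdf_atTop μ).const_sub 1
  rw [sub_self] at this
  exact this.congr fun x => by rw [tail, h]

lemma isAdmissible_tail {F : ℝ → ℝ} (hF : F ∈ distributionsOnRPlus) (hpos : ∀ x, 0 < tail F x) :
    IsAdmissible (tail F) where
  pos x _ := hpos x
  measurable := (antitone_tail hF).measurable.aemeasurable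
  bounded _ _ := ⟨1, fun x _ => tail_le_one hF x⟩

lemma mem_distributionsOnRPlus {F : ℝ → ℝ} (hmono : Monotone F)
    (hright : ∀ x, ContinuousWithinAt F (Set.Ici x) x) (h0 : ∀ x < 0, F x = 0)
    (h1 : Tendsto F atTop (𝓝 1)) : F ∈ distributionsOnRPlus := by
  let f : StieltjesFunction ℝ := ⟨F, hmono, hright⟩
  have hbot : Tendsto f atBot (𝓝 0) :=
    tendsto_const_nhds.congr' ((eventually_lt_atBot 0).mono fun x hx => (h0 x hx).symm)
  refine ⟨⟨f.measure, f.isProbabilityMeasure hbot h1, fun x => ?_⟩, h0⟩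
  rw [ProbabilityTheory.cdf_measure_stieltjesFunction f hbot h1]

/-! ### Domains of attraction in terms of tails -/

/-- If `F (y n) ^ n → exp (-c)` then `n * (1 - F (y n)) → c`: take logarithms and use
`exp l - 1 = l + O(l ^ 2)`. -/
lemma tendsto_mul_tail {F : ℝ → ℝ} (hF : F ∈ distributionsOnRPlus) {y : ℕ → ℝ} {c : ℝ}
    (h : Tendsto (fun n => F (y n) ^ n) atTop (𝓝 (Real.exp (-c)))) :
    Tendsto (fun n : ℕ => n * tail F (y n)) atTop (𝓝 c) := by
  have h1 : Tendsto (fun n : ℕ => n * Real.log (F (y n))) atTop (𝓝 (-c)) := by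
    have := h.log (Real.exp_pos _).ne'
    rw [Real.log_exp] at this
    exact this.congr fun n => Real.log_pow _ _
  have hpos : ∀ᶠ n in atTop, 0 < F (y n) := by
    filter_upwards [h.eventually (lt_mem_nhds (Real.exp_pos _)), eventually_gt_atTop 0] with n hn h0
    refine lt_of_le_of_ne (nonneg_of_mem hF _) fun he => ?_
    rw [← he, zero_pow h0.ne'] at hn
    exact lt_irrefl _ hn
  have h2 : Tendsto (fun n : ℕ => Real.log (F (y n))) atTop (𝓝 0) := by
    have := h1.mul tendsto_one_div_atTop_nhds_zero_nat
    rw [mul_zero] at this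
    refine this.congr' ?_
    filter_upwards [eventually_gt_atTop 0] with n hn
    have : (n : ℝ) ≠ 0 := by positivity
    field_simp
  have h3 : Tendsto (fun n : ℕ => n * Real.log (F (y n)) * Real.log (F (y n))) atTop (𝓝 0) := by
    simpa using h1.mul h2
  have h4 : Tendsto (fun n : ℕ => n * (F (y n) - 1 - Real.log (F (y n)))) atTop (𝓝 0) := by
    refine squeeze_zero_norm' ?_ h3
    filter_upwards [hpos, h2.eventually (Metric.closedBall_mem_nhds 0 one_pos)] with n hn h1
    rw [dist_zero_right, Real.norm_eq_abs] at h1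
    have := Real.abs_exp_sub_one_sub_id_le h1
    rw [Real.exp_log hn] at this
    rw [Real.norm_eq_abs, abs_mul, Nat.abs_cast, mul_assoc, ← sq]
    exact mul_le_mul_of_nonneg_left this (Nat.cast_nonneg _)
  have h5 := (h4.add h1).neg
  rw [zero_add, neg_neg] at h5
  refine h5.congr fun n => ?_
  rw [tail]
  ring

/-- A distribution whose rescaled tails `n * (1 - F)` avoid `(1, 2)` for infinitely many `n` is not
attracted by a law taking the value `exp (-3/2)`. -/
lemma notMem_domainOfAttraction {F G : ℝ → ℝ} (hG : ∃ x, G x = Real.exp (-(3 / 2)))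
    (h : ∃ᶠ n : ℕ in atTop, ∀ y, n * tail F y ∉ Set.Ioo (1 : ℝ) 2) :
    F ∉ domainOfAttraction G := by
  rintro ⟨hF, a, b, -, hab⟩
  obtain ⟨x, hx⟩ := hG
  have h1 := hab x
  rw [hx] at h1
  have h2 := (tendsto_mul_tail hF h1).eventually
    (Ioo_mem_nhds (by norm_num : (1 : ℝ) < 3 / 2) (by norm_num : (3 / 2 : ℝ) < 2))
  obtain ⟨n, hn1, hn2⟩ := (h.and_eventually h2).exists
  exact hn1 _ hn2

lemma exists_frechet_eq {α c : ℝ} (hα : 0 < α) (hc : 0 < c) :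
    ∃ x, frechet α x = Real.exp (-c) := by
  have hx : 0 < c ^ (-α)⁻¹ := Real.rpow_pos_of_pos hc _
  refine ⟨c ^ (-α)⁻¹, ?_⟩
  rw [frechet, if_neg hx.not_ge, Real.rpow_inv_rpow hc.le (neg_ne_zero.2 hα.ne')]

lemma exists_gumbel_eq {c : ℝ} (hc : 0 < c) : ∃ x, gumbel x = Real.exp (-c) :=
  ⟨-Real.log c, by rw [gumbel, neg_neg, Real.exp_log hc]⟩

/-- Convergence of types for a fixed subsampling factor `m`: the normalised point at `m * n` with
parameter `y₀` is located, on the scale of `n`, at the point `y₁` with `g y₁ = g y₀ / m`. -/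
lemma tendsto_rescale {U g : ℝ → ℝ} {a b : ℕ → ℝ} {S : Set ℝ} (hU : Antitone U)
    (ha : ∀ n, 0 < a n) (hS : IsOpen S) (hg : StrictAntiOn g S)
    (h : ∀ y ∈ S, Tendsto (fun n : ℕ => n * U (a n * y + b n)) atTop (𝓝 (g y)))
    {m : ℕ} (hm : 0 < m) {y₀ y₁ : ℝ} (h₀ : y₀ ∈ S) (h₁ : y₁ ∈ S) (hy : m * g y₁ = g y₀) :
    Tendsto (fun n => (a (m * n) * y₀ + b (m * n) - b n) / a n) atTop (𝓝 y₁) := by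
  have hm' : (m : ℝ) ≠ 0 := by positivity
  have hlim : Tendsto (fun n : ℕ => n * U (a (m * n) * y₀ + b (m * n))) atTop (𝓝 (g y₁)) := by
    have h1 := ((h y₀ h₀).comp (tendsto_id.const_mul_atTop' hm)).div_const (m : ℝ)
    rw [← hy, mul_div_cancel_left₀ _ hm'] at h1
    refine h1.congr fun n => ?_
    simp only [Function.comp, id]
    push_cast
    field_simp
  rw [tendsto_order]
  constructor
  · intro l hl
    have h2 : ∀ᶠ y in 𝓝[<] y₁, y ∈ S ∧ l < y ∧ y < y₁ := by
      filter_upwards [mem_nhdsWithin_of_mem_nhds (hS.mem_nhds h₁),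
        mem_nhdsWithin_of_mem_nhds (lt_mem_nhds hl), self_mem_nhdsWithin] with y e1 e2 e3
      exact ⟨e1, e2, e3⟩
    obtain ⟨y, hyS, hly, hyy⟩ := h2.exists
    filter_upwards [hlim.eventually_lt (h y hyS) (hg hyS h₁ hyy)] with n hn
    refine hly.trans ?_
    rw [lt_div_iff₀ (ha n)]
    have : a n * y + b n < a (m * n) * y₀ + b (m * n) := by
      by_contra! hle
      exact hn.not_ge (mul_le_mul_of_nonneg_left (hU hle) (Nat.cast_nonneg n))
    linarith
  · intro l hl
    have h2 : ∀ᶠ y in 𝓝[>] y₁, y ∈ S ∧ y < l ∧ y₁ < y := by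
      filter_upwards [mem_nhdsWithin_of_mem_nhds (hS.mem_nhds h₁),
        mem_nhdsWithin_of_mem_nhds (gt_mem_nhds hl), self_mem_nhdsWithin] with y e1 e2 e3
      exact ⟨e1, e2, e3⟩
    obtain ⟨y, hyS, hly, hyy⟩ := h2.exists
    filter_upwards [(h y hyS).eventually_lt hlim (hg h₁ hyS hyy)] with n hn
    refine lt_of_le_of_lt ?_ hly
    rw [div_le_iff₀ (ha n)]
    have : a (m * n) * y₀ + b (m * n) < a n * y + b n := by
      by_contra! hle
      exact hn.not_ge (mul_le_mul_of_nonneg_left (hU hle) (Nat.cast_nonneg n))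
    linarith

/-- Along the powers of two, the normalised points `a n * y₀ + b n` have eventually increasing
values whose increments have ratios tending to `(y₂ - y₁) / (y₁ - y₀)`, where
`g y₀ = 2 * g y₁ = 4 * g y₂`. The centring `b` cancels. -/
lemma dyadic_increments {U g : ℝ → ℝ} {a b : ℕ → ℝ} {S : Set ℝ} (hU : Antitone U)
    (ha : ∀ n, 0 < a n) (hS : IsOpen S) (hg : StrictAntiOn g S)
    (h : ∀ y ∈ S, Tendsto (fun n : ℕ => n * U (a n * y + b n)) atTop (𝓝 (g y)))
    {y₀ y₁ y₂ : ℝ} (h₀ : y₀ ∈ S) (h₁ : y₁ ∈ S) (h₂ : y₂ ∈ S) (h01 : y₀ < y₁)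
    (hy1 : 2 * g y₁ = g y₀) (hy2 : 4 * g y₂ = g y₀) {x : ℕ → ℝ}
    (hx : ∀ k, x k = a (2 ^ k) * y₀ + b (2 ^ k)) :
    (∀ᶠ k in atTop, x k < x (k + 1)) ∧
      Tendsto (fun k => (x (k + 2) - x (k + 1)) / (x (k + 1) - x k)) atTop
        (𝓝 ((y₂ - y₁) / (y₁ - y₀))) := by
  have hp : Tendsto (fun k : ℕ => 2 ^ k) atTop atTop := tendsto_pow_atTop_atTop_of_one_lt one_lt_two
  have t1 := (tendsto_rescale hU ha hS hg h two_pos h₀ h₁ (by exact_mod_cast hy1)).comp hp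
  have t2 := (tendsto_rescale hU ha hS hg h four_pos h₀ h₂ (by exact_mod_cast hy2)).comp hp
  have e1 : ∀ k, 2 * 2 ^ k = 2 ^ (k + 1) := fun k => by ring
  have e2 : ∀ k, 4 * 2 ^ k = 2 ^ (k + 2) := fun k => by ring
  simp only [Function.comp_def, e1, e2, ← hx] at t1 t2
  have d0 : ∀ k, x k - b (2 ^ k) = a (2 ^ k) * y₀ := fun k => by rw [hx]; ring
  constructor
  · filter_upwards [t1.eventually (lt_mem_nhds h01)] with k hk
    rw [lt_div_iff₀ (ha _)] at hk
    linarith [d0 k]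
  · refine ((t2.sub t1).div (t1.sub_const y₀) (sub_pos.2 h01).ne').congr fun k => ?_
    have := (ha (2 ^ k)).ne'
    have e3 : (x (k + 1) - b (2 ^ k)) / a (2 ^ k) - y₀ = (x (k + 1) - x k) / a (2 ^ k) := by
      rw [eq_div_iff this, sub_mul, div_mul_cancel₀ _ this]
      linarith [d0 k]
    simp only [Pi.div_apply]
    rw [e3, ← sub_div, div_div_div_cancel_right₀ this]
    congr 1
    ring

/-- Members of the domain of attraction of a Fréchet law have positive tails, and
`log t / log (1 - F t) → -1 / α`. -/
lemma frechet_tail {α : ℝ} (hα : 0 < α) {F : ℝ → ℝ} (h : F ∈ domainOfAttraction (frechet α)) :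
    (∀ t, 0 < tail F t) ∧
      Tendsto (fun t => Real.log t / Real.log (tail F t)) atTop (𝓝 (-α⁻¹)) := by
  obtain ⟨hF, a, b, ha, hab⟩ := h
  have hU := antitone_tail hF
  have hconv : ∀ y ∈ Set.Ioi (0 : ℝ),
      Tendsto (fun n : ℕ => n * tail F (a n * y + b n)) atTop (𝓝 (y ^ (-α))) := by
    intro y hy
    have := hab y
    rw [frechet, if_neg (not_le.2 hy)] at this
    exact tendsto_mul_tail hF this
  have hg : StrictAntiOn (fun y : ℝ => y ^ (-α)) (Set.Ioi 0) := fun x hx y _ hxy =>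
    Real.rpow_lt_rpow_of_neg hx hxy (neg_lt_zero.2 hα)
  have hscale : ∀ c : ℝ, 0 < c → c * (c ^ α⁻¹) ^ (-α) = 1 := fun c hc => by
    rw [Real.rpow_neg (Real.rpow_nonneg hc.le _), Real.rpow_inv_rpow hc.le hα.ne',
      mul_inv_cancel₀ hc.ne']
  have hl : (1 : ℝ) < 2 ^ α⁻¹ := Real.one_lt_rpow one_lt_two (inv_pos.2 hα)
  have hfour : (4 : ℝ) ^ α⁻¹ = 2 ^ α⁻¹ * 2 ^ α⁻¹ := by
    rw [← Real.mul_rpow two_pos.le two_pos.le]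
    norm_num
  obtain ⟨hd, hr⟩ := dyadic_increments (y₀ := 1) (y₁ := 2 ^ α⁻¹) (y₂ := 4 ^ α⁻¹) hU ha isOpen_Ioi hg
    hconv (Set.mem_Ioi.2 one_pos) (Set.mem_Ioi.2 (by positivity)) (Set.mem_Ioi.2 (by positivity)) hl
    (by simpa using hscale 2 two_pos) (by simpa using hscale 4 four_pos)
    (x := fun k => a (2 ^ k) * 1 + b (2 ^ k)) (fun k => rfl)
  have hratio : ((4 : ℝ) ^ α⁻¹ - 2 ^ α⁻¹) / (2 ^ α⁻¹ - 1) = 2 ^ α⁻¹ := by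
    rw [hfour, div_eq_iff (by linarith)]
    ring
  rw [hratio] at hr
  have hx := tendsto_atTop_of_diff_ratio hl hd hr
  have h2 : Tendsto (fun k => 2 ^ k * tail F (a (2 ^ k) * 1 + b (2 ^ k))) atTop (𝓝 1) := by
    have := (hconv 1 (Set.mem_Ioi.2 one_pos)).comp
      (tendsto_pow_atTop_atTop_of_one_lt (one_lt_two : (1 : ℕ) < 2))
    rw [Real.one_rpow] at this
    exact this.congr fun k => by simp
  have hpos : ∀ t, 0 < tail F t := by
    intro t
    obtain ⟨k, hk1, hk2⟩ := ((hx.eventually_ge_atTop t).and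
      (h2.eventually (lt_mem_nhds one_pos))).exists
    exact ((mul_pos_iff_of_pos_left (by positivity)).1 hk2).trans_le (hU hk1)
  refine ⟨hpos, ?_⟩
  have := tendsto_log_div_log hU hpos (by linarith) one_pos hx
    (tendsto_ratio_of_diff_ratio hx hd hr) h2
  rwa [Real.log_rpow two_pos, mul_div_cancel_right₀ _ (Real.log_pos one_lt_two).ne'] at this

lemma tail_pos_of_rightEndpoint {F : ℝ → ℝ} (hF : F ∈ distributionsOnRPlus)
    (h : rightEndpoint F = ⊤) (t : ℝ) : 0 < tail F t := by
  by_contra! hle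
  have hle' : 1 ≤ F t := by
    rw [tail] at hle
    linarith
  have : rightEndpoint F ≤ (t : EReal) := by
    refine sSup_le ?_
    rintro s ⟨x, rfl, hx⟩
    rw [EReal.coe_le_coe_iff]
    by_contra! htx
    exact (hle'.trans (monotone_of_mem hF htx.le)).not_gt hx
  rw [h] at this
  exact EReal.coe_ne_top t (top_le_iff.1 this)

/-- Members of the domain of attraction of the Gumbel law with infinite right endpoint satisfy
`log t / log (1 - F t) → 0`. -/
lemma gumbel_tail {F : ℝ → ℝ} (h : F ∈ domainOfAttraction gumbel) (hpos : ∀ t, 0 < tail F t) :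
    Tendsto (fun t => Real.log t / Real.log (tail F t)) atTop (𝓝 0) := by
  obtain ⟨hF, a, b, ha, hab⟩ := h
  have hU := antitone_tail hF
  have hconv : ∀ y ∈ (Set.univ : Set ℝ),
      Tendsto (fun n : ℕ => n * tail F (a n * y + b n)) atTop (𝓝 (Real.exp (-y))) :=
    fun y _ => tendsto_mul_tail hF (hab y)
  have hg : StrictAntiOn (fun y : ℝ => Real.exp (-y)) Set.univ := fun x _ y _ hxy =>
    Real.exp_lt_exp.2 (neg_lt_neg hxy)
  have hlog2 : 0 < Real.log 2 := Real.log_pos one_lt_two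
  have hfour : Real.log 4 = 2 * Real.log 2 := by
    rw [show (4 : ℝ) = 2 ^ 2 by norm_num, Real.log_pow]
    norm_num
  have hscale : ∀ c : ℝ, 0 < c → c * Real.exp (-Real.log c) = 1 := fun c hc => by
    rw [Real.exp_neg, Real.exp_log hc, mul_inv_cancel₀ hc.ne']
  obtain ⟨hd, hr⟩ := dyadic_increments (y₀ := 0) (y₁ := Real.log 2) (y₂ := Real.log 4) hU ha
    isOpen_univ hg hconv trivial trivial trivial hlog2
    (by simpa using hscale 2 two_pos) (by simpa using hscale 4 four_pos)
    (x := fun k => a (2 ^ k) * 0 + b (2 ^ k)) (fun k => rfl)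
  have hratio : (Real.log 4 - Real.log 2) / (Real.log 2 - 0) = 1 := by
    rw [hfour, div_eq_one_iff_eq (by linarith)]
    ring
  rw [hratio] at hr
  have h2 : Tendsto (fun k => 2 ^ k * tail F (a (2 ^ k) * 0 + b (2 ^ k))) atTop (𝓝 1) := by
    have := (hconv 0 trivial).comp
      (tendsto_pow_atTop_atTop_of_one_lt (one_lt_two : (1 : ℕ) < 2))
    rw [neg_zero, Real.exp_zero] at this
    exact this.congr fun k => by simp
  -- infinitely many terms in a half-line `(-∞, t]` would keep the tail away from `0`, whereas it decays like `2 ^ (-k)`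
  have hx : Tendsto (fun k => a (2 ^ k) * 0 + b (2 ^ k)) atTop atTop := by
    refine tendsto_atTop.2 fun t => ?_
    have h3 : Tendsto (fun k : ℕ => (2 : ℝ) ^ k * tail F t) atTop atTop :=
      (tendsto_pow_atTop_atTop_of_one_lt one_lt_two).atTop_mul_const (hpos t)
    filter_upwards [h3.eventually_gt_atTop 2, h2.eventually (gt_mem_nhds one_lt_two)] with k e1 e2
    by_contra! hlt
    have := mul_le_mul_of_nonneg_left (hU hlt.le) (by positivity : (0 : ℝ) ≤ 2 ^ k)
    linarith
  have := tendsto_log_div_log hU hpos one_pos one_pos hx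
    (tendsto_ratio_of_diff_ratio hx hd hr) h2
  simpa using this

lemma mem_classMInfty_of_tendsto_log {F : ℝ → ℝ} (hF : F ∈ distributionsOnRPlus)
    (hpos : ∀ t, 0 < tail F t)
    (h : Tendsto (fun t => Real.log t / Real.log (tail F t)) atTop (𝓝 0)) :
    tail F ∈ classMInfty :=
  ⟨isAdmissible_tail hF hpos, fun _ =>
    tendsto_div_rpow_zero (γ := 0) hpos (tendsto_tail hF) (by rwa [neg_zero]) (by simp)⟩

lemma classM_of_tendsto_log {α : ℝ} (hα : 0 < α) {F : ℝ → ℝ} (hF : F ∈ distributionsOnRPlus)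
    (hpos : ∀ t, 0 < tail F t)
    (h : Tendsto (fun t => Real.log t / Real.log (tail F t)) atTop (𝓝 (-α⁻¹))) :
    tail F ∈ classM ∧ HasPowerOrder (tail F) (-α) ∧ mIndex (tail F) = (α : EReal) := by
  have hadm := isAdmissible_tail hF hpos
  have hord := hasPowerOrder_of_tendsto_log hα hpos (tendsto_tail hF) h
  exact ⟨⟨hadm, -α, hord⟩, hord, hord.mIndex_eq hadm⟩

/-! ### Discretised Pareto distributions -/

/-- The number `k` of the step `2 ^ k ≤ x ^ α < 2 ^ (k + 1)` containing `x`; it is `0` when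
`x ^ α < 2`, in particular for negative `x`, which `max x 0` sends to `0`. -/
noncomputable def stepIndex (α x : ℝ) : ℕ := Nat.log 2 ⌊max x 0 ^ α⌋₊

/-- The law of `Y ^ (1 / α)` for `Y` with the Peter and Paul distribution: the tail is `2 ^ (-k)` on
the step `2 ^ k ≤ x ^ α < 2 ^ (k + 1)`. -/
noncomputable def steppedPareto (α : ℝ) : ℝ → ℝ := fun x => 1 - ((2 : ℝ) ^ stepIndex α x)⁻¹

lemma tail_steppedPareto (α x : ℝ) : tail (steppedPareto α) x = ((2 : ℝ) ^ stepIndex α x)⁻¹ :=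
  sub_sub_cancel _ _

lemma monotone_max_rpow {α : ℝ} (hα : 0 < α) : Monotone fun x : ℝ => max x 0 ^ α :=
  fun _ _ h => Real.rpow_le_rpow (le_max_right _ _) (max_le_max_right 0 h) hα.le

lemma monotone_stepIndex {α : ℝ} (hα : 0 < α) : Monotone (stepIndex α) :=
  fun _ _ h => Nat.log_mono_right (Nat.floor_mono (monotone_max_rpow hα h))

lemma stepIndex_rpow {α : ℝ} (hα : 0 < α) (k : ℕ) : stepIndex α (((2 : ℝ) ^ k) ^ α⁻¹) = k := by
  rw [stepIndex, max_eq_left (by positivity), Real.rpow_inv_rpow (by positivity) hα.ne']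
  have : ((2 : ℝ) ^ k) = ((2 ^ k : ℕ) : ℝ) := by push_cast; rfl
  rw [this, Nat.floor_natCast, Nat.log_pow one_lt_two]

lemma tendsto_stepIndex {α : ℝ} (hα : 0 < α) : Tendsto (stepIndex α) atTop atTop :=
  tendsto_atTop_atTop_of_monotone (monotone_stepIndex hα) fun k =>
    ⟨((2 : ℝ) ^ k) ^ α⁻¹, (stepIndex_rpow hα k).ge⟩

lemma tendsto_natFloor_right_pure (x : ℝ) :
    Tendsto (fun y : ℝ => ⌊y⌋₊) (𝓝[≥] x) (pure ⌊x⌋₊) := by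
  simp only [← Int.floor_toNat]
  exact (tendsto_pure_pure Int.toNat ⌊x⌋).comp (tendsto_floor_right_pure_floor x)

lemma tendsto_stepIndex_right {α : ℝ} (hα : 0 < α) (x : ℝ) :
    Tendsto (stepIndex α) (𝓝[≥] x) (pure (stepIndex α x)) := by
  have h1 : Tendsto (fun y : ℝ => max y 0 ^ α) (𝓝[≥] x) (𝓝[≥] (max x 0 ^ α)) := by
    refine tendsto_nhdsWithin_iff.2 ⟨?_, ?_⟩
    · have : Continuous fun y : ℝ => max y 0 ^ α :=
        (continuous_id.max continuous_const).rpow_const fun _ => Or.inr hα.le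
      exact (this.tendsto x).mono_left nhdsWithin_le_nhds
    · filter_upwards [self_mem_nhdsWithin] with y hy
      exact monotone_max_rpow hα hy
  exact (tendsto_pure_pure (Nat.log 2) _).comp ((tendsto_natFloor_right_pure _).comp h1)

lemma steppedPareto_mem {α : ℝ} (hα : 0 < α) : steppedPareto α ∈ distributionsOnRPlus := by
  refine mem_distributionsOnRPlus (fun x y h => ?_) (fun x => ?_) (fun x hx => ?_) ?_
  · refine sub_le_sub_left (inv_anti₀ (by positivity) ?_) 1
    exact pow_le_pow_right₀ one_le_two (monotone_stepIndex hα h)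
  · have := (tendsto_pure_pure (fun k : ℕ => 1 - ((2 : ℝ) ^ k)⁻¹) _).comp
      (tendsto_stepIndex_right hα x)
    exact this.mono_right (pure_le_nhds _)
  · simp [steppedPareto, stepIndex, max_eq_right hx.le, Real.zero_rpow hα.ne']
  · have h1 : Tendsto (fun k : ℕ => ((2 : ℝ) ^ k)⁻¹) atTop (𝓝 0) :=
      (tendsto_pow_atTop_atTop_of_one_lt one_lt_two).inv_tendsto_atTop
    have h2 := (h1.comp (tendsto_stepIndex hα)).const_sub 1
    rwa [sub_zero] at h2

lemma steppedPareto_classM {α : ℝ} (hα : 0 < α) :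
    tail (steppedPareto α) ∈ classM ∧ HasPowerOrder (tail (steppedPareto α)) (-α) ∧
      mIndex (tail (steppedPareto α)) = (α : EReal) := by
  have hF := steppedPareto_mem hα
  have hpos : ∀ t, 0 < tail (steppedPareto α) t := fun t => by
    rw [tail_steppedPareto]
    positivity
  refine classM_of_tendsto_log hα hF hpos ?_
  have hl : (1 : ℝ) < 2 ^ α⁻¹ := Real.one_lt_rpow one_lt_two (inv_pos.2 hα)
  have hl0 : (0 : ℝ) < 2 ^ α⁻¹ := by linarith
  -- the left endpoints of the steps
  have hx : ∀ k : ℕ, ((2 : ℝ) ^ α⁻¹) ^ k = ((2 : ℝ) ^ k) ^ α⁻¹ := fun k => by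
    rw [← Real.rpow_natCast, ← Real.rpow_natCast, ← Real.rpow_mul two_pos.le,
      ← Real.rpow_mul two_pos.le, mul_comm]
  have h := tendsto_log_div_log (x := fun k => ((2 : ℝ) ^ α⁻¹) ^ k) (antitone_tail hF) hpos hl0
    one_pos (tendsto_pow_atTop_atTop_of_one_lt hl)
    (tendsto_const_nhds.congr fun k => by rw [pow_succ, mul_div_cancel_left₀ _ (by positivity)])
    (tendsto_const_nhds.congr fun k => by
      rw [hx, tail_steppedPareto, stepIndex_rpow hα, mul_inv_cancel₀ (by positivity)])
  rwa [Real.log_rpow two_pos, mul_div_cancel_right₀ _ (Real.log_pos one_lt_two).ne'] at h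

/-- The rescaled tail at `n = 2 ^ m` takes values in the integer powers of `2`. -/
lemma steppedPareto_notMem (α : ℝ) {β : ℝ} (hβ : 0 < β) :
    steppedPareto α ∉ domainOfAttraction (frechet β) := by
  refine notMem_domainOfAttraction (exists_frechet_eq hβ (by norm_num)) ?_
  refine (tendsto_pow_atTop_atTop_of_one_lt (one_lt_two : (1 : ℕ) < 2)).frequently
    (Frequently.of_forall fun m y => ?_)
  rw [tail_steppedPareto]
  rintro ⟨h1, h2⟩
  push_cast at h1 h2
  rw [← div_eq_mul_inv] at h1 h2
  rw [one_lt_div (by positivity), pow_lt_pow_iff_right₀ one_lt_two] at h1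
  rw [div_lt_iff₀ (by positivity), ← pow_succ', pow_lt_pow_iff_right₀ one_lt_two] at h2
  omega

/-- The geometric series defining the Peter and Paul tail, summed from the first `k` with
`x < 2 ^ k` on. -/
lemma peterPaul_eq : peterPaul = steppedPareto 1 := by
  funext x
  have hx : stepIndex 1 x = Nat.log 2 ⌊x⌋₊ := by
    rw [stepIndex, Real.rpow_one]
    rcases le_total x 0 with h | h
    · rw [max_eq_right h, Nat.floor_zero, Nat.floor_of_nonpos h]
    · rw [max_eq_left h]
  rw [peterPaul, steppedPareto, hx]
  congr 1
  have hiff : ∀ k : ℕ, (1 ≤ k ∧ x < (2 : ℝ) ^ k) ↔ Nat.log 2 ⌊x⌋₊ < k := by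
    intro k
    rcases Nat.eq_zero_or_pos k with rfl | hk
    · simp
    · have h1 : x < (2 : ℝ) ^ k ↔ ⌊x⌋₊ < 2 ^ k := by
        rw [Nat.floor_lt' (by positivity)]
        push_cast
        rfl
      rw [h1]
      exact ⟨fun h => Nat.log_lt_of_lt_pow' hk.ne' h.2,
        fun h => ⟨hk, Nat.lt_pow_of_log_lt one_lt_two h⟩⟩
  refine (tsum_congr fun k => if_congr (hiff k) rfl rfl).trans ?_
  clear hiff
  generalize Nat.log 2 ⌊x⌋₊ = N
  refine HasSum.tsum_eq ((hasSum_nat_add_iff' (N + 1)).1 ?_)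
  have hzero : ∑ k ∈ Finset.range (N + 1), (if N < k then ((2 : ℝ) ^ k)⁻¹ else 0) = 0 :=
    Finset.sum_eq_zero fun k hk => if_neg (by rw [Finset.mem_range] at hk; omega)
  rw [hzero, sub_zero]
  have hterm : ∀ n : ℕ, (if N < n + (N + 1) then ((2 : ℝ) ^ (n + (N + 1)))⁻¹ else 0)
      = ((2 : ℝ) ^ (N + 1))⁻¹ * (1 / 2) ^ n := fun n => by
    rw [if_pos (by omega), pow_add, mul_inv, mul_comm, one_div, inv_pow]
  have hvalue : ((2 : ℝ) ^ (N + 1))⁻¹ * 2 = ((2 : ℝ) ^ N)⁻¹ := by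
    rw [pow_succ, mul_inv, mul_assoc, inv_mul_cancel₀ two_ne_zero, mul_one]
  rw [← hvalue]
  simp only [hterm]
  exact hasSum_geometric_two.mul_left _

/-! ### Tails `exp (-⌊x⌋ log x)` -/

/-- A distribution with tail `exp (-⌊x⌋ log x)` for `x ≥ 1`. -/
noncomputable def floorWeibull : ℝ → ℝ := fun x =>
  1 - Real.exp (-(⌊x⌋₊ * Real.log (max x 1)))

lemma floorWeibull_mem : floorWeibull ∈ distributionsOnRPlus := by
  have hlog : ∀ x : ℝ, 0 ≤ Real.log (max x 1) := fun x => Real.log_nonneg (le_max_right _ _)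
  refine mem_distributionsOnRPlus (fun x y h => ?_) (fun x => ?_) (fun x hx => ?_) ?_
  · refine sub_le_sub_left (Real.exp_le_exp.2 (neg_le_neg ?_)) 1
    exact mul_le_mul (Nat.cast_le.2 (Nat.floor_mono h))
      (Real.log_le_log (by positivity) (max_le_max_right 1 h)) (hlog x) (Nat.cast_nonneg _)
  · have h1 : ContinuousWithinAt (fun y : ℝ => (⌊y⌋₊ : ℝ)) (Set.Ici x) x :=
      ((tendsto_pure_pure (fun k : ℕ => (k : ℝ)) _).comp (tendsto_natFloor_right_pure x)).mono_right
        (pure_le_nhds _)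
    have h2 : ContinuousWithinAt (fun y : ℝ => Real.log (max y 1)) (Set.Ici x) x :=
      ((continuous_id.max continuous_const).log fun y =>
        (lt_max_of_lt_right one_pos).ne').continuousWithinAt
    exact continuousWithinAt_const.sub (h1.mul h2).neg.rexp
  · simp [floorWeibull, max_eq_right (hx.le.trans zero_le_one)]
  · have h1 : Tendsto (fun x : ℝ => (⌊x⌋₊ : ℝ) * Real.log (max x 1)) atTop atTop := by
      refine (tendsto_natCast_atTop_atTop.comp tendsto_nat_floor_atTop).atTop_mul_atTop₀
        (Real.tendsto_log_atTop.comp (tendsto_atTop_mono (fun x => le_max_left x 1) tendsto_id))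
    have h2 := (Real.tendsto_exp_atBot.comp (tendsto_neg_atTop_atBot.comp h1)).const_sub 1
    rwa [sub_zero] at h2

lemma tail_floorWeibull :
    ∀ᶠ x : ℝ in atTop, tail floorWeibull x = Real.exp (-(⌊x⌋ : ℝ) * Real.log x) := by
  filter_upwards [eventually_ge_atTop 1] with x hx
  rw [tail, floorWeibull, sub_sub_cancel, max_eq_left hx, neg_mul,
    natCast_floor_eq_intCast_floor (zero_le_one.trans hx)]

lemma classMInfty_of_floor_tail {F : ℝ → ℝ} (hF : F ∈ distributionsOnRPlus)
    (h : ∀ᶠ x : ℝ in atTop, tail F x = Real.exp (-(⌊x⌋ : ℝ) * Real.log x)) :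
    tail F ∈ classMInfty := by
  have hpos : ∀ t, 0 < tail F t := by
    intro t
    obtain ⟨x, hx, htx⟩ := (h.and (eventually_ge_atTop t)).exists
    exact (hx ▸ Real.exp_pos _ : 0 < tail F x).trans_le (antitone_tail hF htx)
  refine mem_classMInfty_of_tendsto_log hF hpos ?_
  have h1 : Tendsto (fun t : ℝ => -((⌊t⌋ : ℝ))⁻¹) atTop (𝓝 0) := by
    rw [← neg_zero]
    exact (tendsto_intCast_atTop_atTop.comp tendsto_floor_atTop).inv_tendsto_atTop.neg
  refine h1.congr' ?_
  filter_upwards [h, eventually_gt_atTop 1] with t ht h1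
  have : Real.log t ≠ 0 := (Real.log_pos h1).ne'
  rw [ht, Real.log_exp, neg_mul, div_neg, div_mul_cancel_right₀ this]

/-- The tail jumps at an integer `m` from `m ^ (-(m - 1))` to `m ^ (-m)`, so that the rescaled tail
at `n = m ^ m` avoids `(1, m)`. -/
lemma notMem_gumbel_of_floor_tail {F : ℝ → ℝ} (hF : F ∈ distributionsOnRPlus)
    (h : ∀ᶠ x : ℝ in atTop, tail F x = Real.exp (-(⌊x⌋ : ℝ) * Real.log x)) :
    F ∉ domainOfAttraction gumbel := by
  refine notMem_domainOfAttraction (exists_gumbel_eq (by norm_num)) ?_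
  obtain ⟨X, hX⟩ := eventually_atTop.1 (h.and (eventually_ge_atTop 1))
  have hX1 : 1 ≤ X := (hX X le_rfl).2
  have hUX : 0 < tail F X := by
    rw [(hX X le_rfl).1]
    exact Real.exp_pos _
  have hmm : Tendsto (fun m : ℕ => m ^ m) atTop atTop :=
    tendsto_atTop_mono (fun m => by
      rcases eq_or_ne m 0 with rfl | h
      · simp
      · exact Nat.le_self_pow h m) tendsto_id
  refine hmm.frequently (Eventually.frequently ?_)
  have hbig := ((tendsto_natCast_atTop_atTop (R := ℝ)).comp hmm).atTop_mul_const hUX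
  filter_upwards [hbig.eventually_ge_atTop 2, eventually_ge_atTop 2] with m hm2 hm y hy
  have hm0 : (0 : ℝ) < m := by positivity
  have hlog : 0 ≤ Real.log m := Real.log_natCast_nonneg m
  have hpow : ((m ^ m : ℕ) : ℝ) = Real.exp (m * Real.log m) := by
    rw [← Real.log_pow, Real.exp_log (by positivity)]
    push_cast
    rfl
  rcases le_total y X with hyX | hyX
  · have := mul_le_mul_of_nonneg_left (antitone_tail hF hyX) (Nat.cast_nonneg (α := ℝ) (m ^ m))
    exact (hm2.trans this).not_gt hy.2
  rw [(hX y hyX).1, hpow, ← Real.exp_add] at hy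
  have hy1 : 1 ≤ y := hX1.trans hyX
  have hlogy : 0 ≤ Real.log y := Real.log_nonneg hy1
  rcases lt_or_ge y m with hym | hym
  · have h1 : ⌊y⌋ < (m : ℤ) := Int.floor_lt.2 (by exact_mod_cast hym)
    have h2 : (⌊y⌋ : ℝ) ≤ m - 1 := by
      have : ⌊y⌋ ≤ (m : ℤ) - 1 := by omega
      exact_mod_cast this
    have h3 : (⌊y⌋ : ℝ) * Real.log y ≤ (m - 1) * Real.log m :=
      mul_le_mul h2 (Real.log_le_log (by linarith) hym.le) hlogy
        (by have : (2 : ℝ) ≤ m := by exact_mod_cast hm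
            linarith)
    have h4 : (2 : ℝ) ≤ Real.exp (m * Real.log m + -(⌊y⌋ : ℝ) * Real.log y) :=
      calc (2 : ℝ) ≤ m := by exact_mod_cast hm
        _ = Real.exp (Real.log m) := (Real.exp_log hm0).symm
        _ ≤ _ := Real.exp_le_exp.2 (by linarith)
    exact h4.not_gt hy.2
  · have h1 : (m : ℝ) ≤ ⌊y⌋ := by
      have : (m : ℤ) ≤ ⌊y⌋ := Int.le_floor.2 (by exact_mod_cast hym)
      exact_mod_cast this
    have h3 : (m : ℝ) * Real.log m ≤ ⌊y⌋ * Real.log y :=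
      mul_le_mul h1 (Real.log_le_log hm0 hym) hlog (hm0.le.trans h1)
    exact (Real.exp_le_one_iff.2 (by linarith)).not_gt hy.1

end TailClasses

theorem mainTheorem6 :
    -- (i) for each `α > 0`
    (∀ α : ℝ, 0 < α →
      (∀ F ∈ domainOfAttraction (frechet α),
        tail F ∈ classM ∧ HasPowerOrder (tail F) (-α) ∧ mIndex (tail F) = (α : EReal)) ∧
      domainOfAttraction (frechet α) ⊂
        {F | F ∈ distributionsOnRPlus ∧ tail F ∈ classM ∧
          HasPowerOrder (tail F) (-α) ∧ mIndex (tail F) = (α : EReal)}) ∧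
    -- (i) for all `α > 0` together
    {F | ∃ α : ℝ, 0 < α ∧ F ∈ domainOfAttraction (frechet α)} ⊂
      {F | F ∈ distributionsOnRPlus ∧ tail F ∈ classM} ∧
    -- the Peter and Paul distribution shows strictness in (i)
    (peterPaul ∈ distributionsOnRPlus ∧ tail peterPaul ∈ classM ∧
      HasPowerOrder (tail peterPaul) (-1) ∧ mIndex (tail peterPaul) = 1 ∧
      ∀ α : ℝ, 0 < α → peterPaul ∉ domainOfAttraction (frechet α)) ∧
    -- (ii)
    daGumbelInfty ⊂ {F | F ∈ distributionsOnRPlus ∧ tail F ∈ classMInfty} ∧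
    -- every distribution with tail `exp (-⌊x⌋ log x)` near `∞` shows strictness in (ii),
    -- and there is such a distribution
    (∃ F ∈ distributionsOnRPlus,
      ∀ᶠ x : ℝ in Filter.atTop, tail F x = Real.exp (-(⌊x⌋ : ℝ) * Real.log x)) ∧
    (∀ F ∈ distributionsOnRPlus,
      (∀ᶠ x : ℝ in Filter.atTop, tail F x = Real.exp (-(⌊x⌋ : ℝ) * Real.log x)) →
      tail F ∈ classMInfty ∧ F ∉ daGumbelInfty) := by
  refine ⟨fun α hα => ⟨fun F hF => ?_, ?_⟩, ?_, ?_, ?_, ?_, fun F hF h => ?_⟩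
  · obtain ⟨hpos, hlog⟩ := frechet_tail hα hF
    exact classM_of_tendsto_log hα hF.1 hpos hlog
  · refine Set.ssubset_iff_of_subset (fun F hF => ?_) |>.2 ⟨steppedPareto α, ?_, ?_⟩
    · obtain ⟨hpos, hlog⟩ := frechet_tail hα hF
      exact ⟨hF.1, classM_of_tendsto_log hα hF.1 hpos hlog⟩
    · exact ⟨steppedPareto_mem hα, steppedPareto_classM hα⟩
    · exact steppedPareto_notMem α hα
  · refine Set.ssubset_iff_of_subset ?_ |>.2 ⟨steppedPareto 1, ?_, ?_⟩
    · rintro F ⟨α, hα, hF⟩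
      obtain ⟨hpos, hlog⟩ := frechet_tail hα hF
      exact ⟨hF.1, (classM_of_tendsto_log hα hF.1 hpos hlog).1⟩
    · exact ⟨steppedPareto_mem one_pos, (steppedPareto_classM one_pos).1⟩
    · rintro ⟨α, hα, hF⟩
      exact steppedPareto_notMem 1 hα hF
  · rw [peterPaul_eq]
    obtain ⟨h1, h2, h3⟩ := steppedPareto_classM one_pos
    exact ⟨steppedPareto_mem one_pos, h1, h2, h3, fun α hα => steppedPareto_notMem 1 hα⟩
  · refine Set.ssubset_iff_of_subset (fun F hF => ?_) |>.2 ⟨floorWeibull, ?_, fun hF => ?_⟩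
    · have hpos := tail_pos_of_rightEndpoint hF.1.1 hF.2
      exact ⟨hF.1.1, mem_classMInfty_of_tendsto_log hF.1.1 hpos (gumbel_tail hF.1 hpos)⟩
    · exact ⟨floorWeibull_mem, classMInfty_of_floor_tail floorWeibull_mem tail_floorWeibull⟩
    · exact notMem_gumbel_of_floor_tail floorWeibull_mem tail_floorWeibull hF.1
  · exact ⟨floorWeibull, floorWeibull_mem, tail_floorWeibull⟩
  · exact ⟨classMInfty_of_floor_tail hF h, fun hG => notMem_gumbel_of_floor_tail hF h hG.1⟩
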